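/- **Setting.** Let $\mathcal S$ and $\mathcal A\neq\emptyset$ be finite sets, $P^a_{s,s'}$ a transition matrix for each $a\in\mathcal A$, $r:\mathcal S\times\mathcal A\times\mathcal S\to\mathbb R$ a reward function, $\gamma\in[0,1)$ and $\beta\ge 0$. Let $\mathcal C=\{0,1\}$, $\mathcal O=\mathcal S\cup\{\chi\}$, and let $o(s,1)=s$, $o(s,0)=\chi$. Let $\Omega$ be the probability simplex over $\mathcal S$. *Push-based problem $\mathcal M$.* The initial state $s_0$ has law $\mu\in\Omega$. At each time $t\ge 0$ an encoder, knowing $s_0,\dots,s_t$ and $o_0,\dots,o_{t-1}$, chooses $c_t\in\mathcal C$; then a decoder, knowing $o_0,\dots,o_t$ with $o_t=o(s_t,c_t)$, chooses $a_t\in\mathcal A$; and $s_{t+1}$ is drawn from $P^{a_t}_{s_t,\cdot}$. Over all deterministic causal joint policies $\pi$, maximize $$J_\mu(\pi)=\mathbb E_{\mu,\pi}\Big[\sum_{t\ge0}\gamma^t\big(r(s_t,a_t,s_{t+1})-\beta c_t\big)\Big].$$ *Single-agent POMDP $\hat{\mathcal M}$.* The states are $\mathcal S$, the observations $\mathcal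 O$, the actions $\hat{\mathcal A}=\mathcal A\times\mathcal C^{|\mathcal S|}$. Under the action $\langle a,\mathbf c\rangle$ the state moves from $s$ to $s'$ with probability $P^a_{s,s'}$, the agent then observes $o(s',\mathbf c_{s'})$, and the reward is $$\hat r(s,\langle a,\mathbf c\rangle)=\sum_{s'\in\mathcal S}P^a_{s,s'}\big(r(s,a,s')-\gamma\beta\,\mathbf c_{s'}\big).$$ For an initial belief $\omega_0\in\Omega$, a history policy $\hat\pi$ chooses $\hat a_t\in\hat{\mathcal A}$ as a function of the observations $o_1,\dots,o_t$ after time $0$; write $\hat V^{\hat\pi}(\omega_0)=\sum_{t\ge 0}\gamma^t\,\mathbb E_{\omega_0,\hat\pi}[\hat r(s_t,\hat a_t)]$. A belief policy is a map $\hat\pi:\Omega\to\hat{\mathcal A}$, used as $\hat a_t=\hat\pi(\omega_t)$, where $\omega_{t+1}$ is obtained from $\omega_t$, $\hat a_t$ and $o_{t+1}$ by Bayes' rule (with an arbitrary fixed convention for observations of probability zero). A belief policy is optimal from $\omega_0$ if it attains $$\max_{\hat\pi:\Omega\to\hat{\mathcal A}}\ \sum_{t=0}^\infty\gamma^t\,\mathbb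 E_{\omega_0,\hat\pi}\big[\hat r(s_t,\hat\pi(\omega_t))\big].\tag{$*$}$$ *Splitting.* A first-step encoder policy $e_0:\mathcal S\to\mathcal C$ and a history policy $\hat\pi^{o_0}$ of $\hat{\mathcal M}$ for each first message $o_0\in\mathcal O$ are split into the joint policy with $c_0=e_0(s_0)$ and, if $\hat\pi^{o_0}$ chooses $\langle a,\mathbf c\rangle$ after $o_1,\dots,o_t$, with $a_t=a$ and $c_{t+1}=\mathbf c_{s_{t+1}}$. Let $\omega_0(\mu,e_0,o_0)$ be the conditional law of $s_0$ given $o(s_0,e_0(s_0))=o_0$, and, with $o_0=o(s,e_0(s))$ in the sum, let $$G_\mu(e_0,\hat\pi)=\sum_{s\in\mathcal S}\mu(s)\Big[\hat V^{\hat\pi^{o_0}}\big(\omega_0(\mu,e_0,o_0)\big)-\beta e_0(s)\Big].$$ **Theorem.** The push-based problem $\mathcal M$ is equivalent to the single-agent POMDP $\hat{\mathcal M}$, and an optimal belief-based stationary deterministic policy of $\hat{\mathcal M}$ gives an optimal joint encoder/decoder policy. That is: 1. The series of expected discounted rewards converge. Splitting is a bijection from the pairs $(e_0,(\hat\pi^{o_0})_{o_0\in\mathcal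 O})$ onto the joint policies whose encoder uses only $s_t$ and $o_0,\dots,o_{t-1}$ at each time $t$, and for every $\mu$ the joint policy $\pi$ split from $(e_0,\hat\pi)$ satisfies $J_\mu(\pi)=G_\mu(e_0,\hat\pi)$. Moreover $\pi$ maximizes $J_\mu$ over all deterministic causal joint policies if and only if $(e_0,\hat\pi)$ maximizes $G_\mu$. 2. There is a belief policy $\hat\pi^*:\Omega\to\hat{\mathcal A}$ that is optimal from every $\omega_0\in\Omega$ simultaneously; and every belief policy that is optimal from $\omega_0$, i.e. attains $(*)$, is optimal from $\omega_0$ among all history policies. 3. Let $\hat\pi^*$ be a belief policy that is optimal from each possible initial belief $\omega_0(\mu,e_0,o(s,e_0(s)))$, $e_0:\mathcal S\to\mathcal C$, $\mu(s)>0$. Then there is an $e_0^*$ that maximizes, over $e_0:\mathcal S\to\mathcal C$, $$\sum_{s\in\mathcal S}\mu(s)\Big[\hat V^{\hat\pi^*}\big(\omega_0(\mu,e_0,o(s,e_0(s)))\big)-\beta e_0(s)\Big],$$ and for every such $e_0^*$ the joint policy obtained by splitting $e_0^*$ and $\hat\pi^*$ (so that $a_t$ is a function of $\omega_t$, and $c_{t+1}$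 of $\omega_t$ and $s_{t+1}$) maximizes $J_\mu$ over all deterministic causal joint policies. -/

import Mathlib

open scoped BigOperators

noncomputable section

namespace RemoteControl

/-! ### Beliefs -/

/-- The probability simplex over the finite set `S`: the space of belief distributions. -/
abbrev Belief (S : Type*) [Fintype S] : Type _ := stdSimplex ℝ S

namespace Belief

variable {S : Type*} [Fintype S]

/-- Mass that `ω` gives to the event `E`. -/
def mass (ω : Belief S) (E : Set S) : ℝ := ∑ s, E.indicator ω s

/-- Bayesian conditioning of `ω` on the event `E`. The Bayes quotient makes sense only if `E` has
positive mass; conditioning on an event of mass zero leaves `ω` unchanged by convention. -/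
def condition (ω : Belief S) (E : Set S) : Belief S :=
  if h : ω.mass E = 0 then ω
  else
    ⟨fun s => E.indicator ω s / ω.mass E, by
      have h0 : ∀ s, 0 ≤ E.indicator ω s := fun s =>
        Set.indicator_nonneg (fun x _ => stdSimplex.zero_le ω x) s
      refine ⟨fun s => div_nonneg (h0 s) (Finset.sum_nonneg fun i _ => h0 i), ?_⟩
      rw [← Finset.sum_div]
      exact div_self h⟩

/-- The one-step prediction `s' ↦ ∑ s, ω s * p s s'` of `ω` through the stochastic matrix `p`. -/
def predict (ω : Belief S) (p : S → Belief S) : Belief S :=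
  ⟨fun s' => ∑ s, ω s * p s s', by
    refine ⟨fun s' => Finset.sum_nonneg fun s _ =>
      mul_nonneg (stdSimplex.zero_le ω s) (stdSimplex.zero_le (p s) s'), ?_⟩
    rw [Finset.sum_comm]
    simp_rw [← Finset.mul_sum, stdSimplex.sum_eq_one, mul_one]
    exact stdSimplex.sum_eq_one ω⟩

end Belief

/-! ### Finite discounted POMDPs -/

/-- A discounted POMDP with finite state space `S`, observations in `O`, actions in `U`; after
action `u` the system enters a state `s'` drawn from `P s u` and the agent observes `obs s' u`. -/
structure POMDP (S O U : Type*) [Fintype S] where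
  P : S → U → Belief S
  obs : S → U → O
  r : S → U → ℝ
  γ : ℝ
  γ_nonneg : 0 ≤ γ
  γ_lt_one : γ < 1

/-- Deterministic history-dependent policies: the action at time `t` is a function of the
observations `o₁, …, o_t` received so far. (Past actions are functions of these.) -/
abbrev HistoryPolicy (O U : Type*) : Type _ := ∀ t : ℕ, (Fin t → O) → U

/-- Stationary deterministic policies that depend on the current belief only. -/
abbrev BeliefPolicy (S U : Type*) [Fintype S] : Type _ := Belief S → U

namespace POMDP

variable {S O U : Type*} [Fintype S] (M : POMDP S O U)

/-- The observations `o₁, …, o_t` received along the states `s₀, …, s_t` under `π`. -/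
def observations (π : HistoryPolicy O U) : ∀ t : ℕ, (Fin (t + 1) → S) → (Fin t → O)
  | 0, _ => Fin.elim0
  | t + 1, x =>
      Fin.snoc (observations π t (Fin.init x))
        (M.obs (x (Fin.last (t + 1))) (π t (observations π t (Fin.init x))))

/-- The action taken at time `t` along the states `s₀, …, s_t` under `π`. -/
def action (π : HistoryPolicy O U) (t : ℕ) (x : Fin (t + 1) → S) : U :=
  π t (M.observations π t x)

/-- The probability of the state path `s₀, …, s_t` under `π`, when `s₀` has law `ω₀`. -/
def pathProb (ω₀ : Belief S) (π : HistoryPolicy O U) : ∀ t : ℕ, (Fin (t + 1) → S) → ℝ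
  | 0, x => ω₀ (x 0)
  | t + 1, x =>
      pathProb ω₀ π t (Fin.init x) *
        M.P (x (Fin.last t).castSucc) (M.action π t (Fin.init x)) (x (Fin.last (t + 1)))

/-- The expected reward at time `t`. -/
def stageReward (ω₀ : Belief S) (π : HistoryPolicy O U) (t : ℕ) : ℝ :=
  ∑ x : Fin (t + 1) → S, M.pathProb ω₀ π t x * M.r (x (Fin.last t)) (M.action π t x)

/-- The expected discounted reward of a history-dependent policy from the initial belief `ω₀`. -/
def value (ω₀ : Belief S) (π : HistoryPolicy O U) : ℝ :=
  ∑' t : ℕ, M.γ ^ t * M.stageReward ω₀ π t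

/-- The Bayesian belief update: predict with action `u`, then condition on observing `o`. -/
def beliefUpdate (ω : Belief S) (u : U) (o : O) : Belief S :=
  (ω.predict fun s => M.P s u).condition {s' | M.obs s' u = o}

/-- The belief `ω_t` of an agent that starts from `ω₀`, follows the belief policy `π` and has
received the observations `o₁, …, o_t`. -/
def belief (ω₀ : Belief S) (π : BeliefPolicy S U) : ∀ t : ℕ, (Fin t → O) → Belief S
  | 0, _ => ω₀
  | t + 1, o =>
      M.beliefUpdate (belief ω₀ π t (Fin.init o)) (π (belief ω₀ π t (Fin.init o)))
        (o (Fin.last t))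

/-- The behaviour, from the initial belief `ω₀`, of the belief policy `π`. -/
def ofBeliefPolicy (ω₀ : Belief S) (π : BeliefPolicy S U) : HistoryPolicy O U :=
  fun t o => π (M.belief ω₀ π t o)

/-- The expected discounted reward of a belief policy from the initial belief `ω₀`. -/
def beliefValue (ω₀ : Belief S) (π : BeliefPolicy S U) : ℝ :=
  M.value ω₀ (M.ofBeliefPolicy ω₀ π)

/-- `π` attains the maximum, over all belief policies, of the expected discounted reward from the
initial belief `ω₀`. -/
def IsOptimalBeliefPolicy (ω₀ : Belief S) (π : BeliefPolicy S U) : Prop :=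
  ∀ π' : BeliefPolicy S U, M.beliefValue ω₀ π' ≤ M.beliefValue ω₀ π

end POMDP

/-! ### The push-based remote control problem -/

/-- The data of the problem: a controlled Markov chain on `S` with actions in `A`, a reward
`r s a s'`, a discount factor and the price `β` of one transmission. -/
structure Model (S A : Type*) [Fintype S] where
  P : S → A → Belief S
  r : S → A → S → ℝ
  γ : ℝ
  γ_nonneg : 0 ≤ γ
  γ_lt_one : γ < 1
  β : ℝ
  β_nonneg : 0 ≤ β

/-- What the decoder observes: the state if it is transmitted (`true`), and otherwise the symbol
`none` for the absence of a transmission. -/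
def message {S : Type*} (s : S) (c : Bool) : Option S := if c then some s else none

/-- The communication action as a number: `1` for a transmission, `0` for none. -/
def cost (c : Bool) : ℝ := if c then 1 else 0

/-- A deterministic causal joint policy. At time `t` the encoder knows the states `s₀, …, s_t` and
the messages `o₀, …, o_{t-1}`; the decoder knows the messages `o₀, …, o_t`. -/
structure JointPolicy (S A : Type*) where
  enc : ∀ t : ℕ, (Fin (t + 1) → S) → (Fin t → Option S) → Bool
  dec : ∀ t : ℕ, (Fin (t + 1) → Option S) → A

namespace JointPolicy

variable {S A : Type*} (π : JointPolicy S A)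

/-- The messages sent along the states `s₀, …, s_{t-1}`. -/
def messages : ∀ t : ℕ, (Fin t → S) → (Fin t → Option S)
  | 0, _ => Fin.elim0
  | t + 1, x =>
      Fin.snoc (messages t (Fin.init x))
        (message (x (Fin.last t)) (π.enc t x (messages t (Fin.init x))))

/-- The communication action `c_t` along the states `s₀, …, s_t`. -/
def comm (t : ℕ) (x : Fin (t + 1) → S) : Bool := π.enc t x (π.messages t (Fin.init x))

/-- The control action `a_t` along the states `s₀, …, s_t`. -/
def control (t : ℕ) (x : Fin (t + 1) → S) : A := π.dec t (π.messages (t + 1) x)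

/-- The encoder uses, of the state history, the current state only. -/
def IsReduced : Prop :=
  ∀ (t : ℕ) (x x' : Fin (t + 1) → S) (o : Fin t → Option S),
    x (Fin.last t) = x' (Fin.last t) → π.enc t x o = π.enc t x' o

end JointPolicy

namespace Model

variable {S A : Type*} [Fintype S] (M : Model S A)

/-- The probability of the state path `s₀, …, s_t` under `π`, when `s₀` has law `μ`. -/
def pathProb (μ : Belief S) (π : JointPolicy S A) : ∀ t : ℕ, (Fin (t + 1) → S) → ℝ
  | 0, x => μ (x 0)
  | t + 1, x =>
      pathProb μ π t (Fin.init x) *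
        M.P (x (Fin.last t).castSucc) (π.control t (Fin.init x)) (x (Fin.last (t + 1)))

/-- The expectation of `r_t - β c_t`. -/
def stageReward (μ : Belief S) (π : JointPolicy S A) (t : ℕ) : ℝ :=
  ∑ x : Fin (t + 2) → S, M.pathProb μ π (t + 1) x *
    (M.r (x (Fin.last t).castSucc) (π.control t (Fin.init x)) (x (Fin.last (t + 1)))
      - M.β * cost (π.comm t (Fin.init x)))

/-- The objective of the push-based problem: the expectation of `∑ t, γ ^ t * (r_t - β c_t)`. -/
def objective (μ : Belief S) (π : JointPolicy S A) : ℝ :=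
  ∑' t : ℕ, M.γ ^ t * M.stageReward μ π t

/-- `π` solves the push-based problem for the initial state distribution `μ`. -/
def IsOptimal (μ : Belief S) (π : JointPolicy S A) : Prop :=
  ∀ π' : JointPolicy S A, M.objective μ π' ≤ M.objective μ π

/-- The single-agent POMDP. An action `(a, c)` consists of the control action `a` and of a vector
`c` that says, for each state, whether the encoder transmits if that is the *next* state. -/
def jointPOMDP : POMDP S (Option S) (A × (S → Bool)) where
  P s u := M.P s u.1
  obs s' u := message s' (u.2 s')
  r s u := ∑ s', M.P s u.1 s' * (M.r s u.1 s' - M.γ * M.β * cost (u.2 s'))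
  γ := M.γ
  γ_nonneg := M.γ_nonneg
  γ_lt_one := M.γ_lt_one

/-- The belief `ω₀` of the decoder after the first message `o₀`, when the initial state has law `μ`
and the first communication action is `e₀ s₀`. -/
def initialBelief (μ : Belief S) (e₀ : S → Bool) (o₀ : Option S) : Belief S :=
  μ.condition {s | message s (e₀ s) = o₀}

/-- The possible beliefs `ω₀`, over all first-step encoder policies and initial states. -/
def initialBeliefs (μ : Belief S) : Set (Belief S) :=
  {ω | ∃ (e₀ : S → Bool) (s : S), 0 < μ s ∧ ω = initialBelief μ e₀ (message s (e₀ s))}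

/-- The joint policy obtained from a first-step encoder policy `e₀` and from a POMDP policy `π o₀`
for each first message `o₀`, by handing the first component of each POMDP action to the decoder
and the second one, at the next time step, to the encoder. -/
def split (e₀ : S → Bool) (π : Option S → HistoryPolicy (Option S) (A × (S → Bool))) :
    JointPolicy S A where
  enc
    | 0, x, _ => e₀ (x 0)
    | t + 1, x, o => (π (o 0) t (Fin.tail o)).2 (x (Fin.last (t + 1)))
  dec t o := (π (o 0) t (Fin.tail o)).1

/-- The value in the POMDP of the pair `(e₀, π)`: the expectation over `s₀` of the POMDP value from
the belief after the first message, less the cost of that message. -/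
def pomdpObjective (μ : Belief S) (e₀ : S → Bool)
    (π : Option S → HistoryPolicy (Option S) (A × (S → Bool))) : ℝ :=
  ∑ s, μ s *
    (M.jointPOMDP.value (initialBelief μ e₀ (message s (e₀ s))) (π (message s (e₀ s)))
      - M.β * cost (e₀ s))

/-- The behaviour of a belief policy of the POMDP after each first message. -/
def followBelief (μ : Belief S) (e₀ : S → Bool) (π : BeliefPolicy S (A × (S → Bool))) :
    Option S → HistoryPolicy (Option S) (A × (S → Bool)) :=
  fun o₀ => M.jointPOMDP.ofBeliefPolicy (initialBelief μ e₀ o₀) π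

/-- `e₀` maximizes the first-step criterion, in which the continuation is valued by the belief
policy `π`. -/
def IsOptimalFirstStep (μ : Belief S) (π : BeliefPolicy S (A × (S → Bool)))
    (e₀ : S → Bool) : Prop :=
  ∀ e₀' : S → Bool,
    ∑ s, μ s * (M.jointPOMDP.beliefValue (initialBelief μ e₀' (message s (e₀' s))) π
        - M.β * cost (e₀' s)) ≤
      ∑ s, μ s * (M.jointPOMDP.beliefValue (initialBelief μ e₀ (message s (e₀ s))) π
        - M.β * cost (e₀ s))

end Model

end RemoteControl

end

noncomputable section

namespace RemoteControl

/-! ### Sums over paths -/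

/-! Charging the cost of `c_{t+1}` at time `t`, discounted by `γ`, turns the objective into the
discounted sum of `r_t - γ β c_{t+1}`, less the expected cost of `c_0`. A prescription chosen at
time `t` then plays the role of the encoder at time `t + 1`, so a split policy and its POMDP
policies generate the same paths and rewards (`objective_split`).

The real issue is an encoder that uses the whole state history. Given the messages and the next
state, it acts like a randomized prescription: of the predicted weight `n s'` it leaves some `v s'`
in `[0, n s']` untransmitted. The optimal POMDP value, as a function of unnormalized weights, is a
supremum of linear functions, hence convex and positively homogeneous. A transmission leaves weight
on a single state, so its contribution is linear in `v`. The Bellman expression is therefore convex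
on the box of all `v` and is dominated by its value at some vertex, that is, at a deterministic
prescription (`randomized_le_optimalValue`). Hence stage reward plus discounted next potential never
exceeds the current potential (`shiftedReward_add_potential_le`), and telescoping bounds every joint
policy by the optimal POMDP value after the same first step.

That value is attained by a belief policy: the supremum over history policies satisfies the Bellman
equation, and contraction shows that a greedy belief policy achieves it (`beliefValue_greedy`).
Unnormalized weights keep conditioning on null events out of these arguments. -/

theorem sum_cons {S R : Type*} [Fintype S] [AddCommMonoid R] {n : ℕ} (f : (Fin (n + 1) → S) → R) :
    ∑ x, f x = ∑ s, ∑ x : Fin n → S, f (Fin.cons s x) := by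
  rw [← (Fin.consEquiv fun _ => S).sum_comp, Fintype.sum_prod_type]
  rfl

theorem sum_snoc {S R : Type*} [Fintype S] [AddCommMonoid R] {n : ℕ} (f : (Fin (n + 1) → S) → R) :
    ∑ x, f x = ∑ x : Fin n → S, ∑ s, f (Fin.snoc x s) := by
  rw [← (Fin.snocEquiv fun _ => S).sum_comp, Fintype.sum_prod_type_right]
  rfl

theorem init_cons {S : Type*} {n : ℕ} (s : S) (x : Fin (n + 1) → S) :
    Fin.init (Fin.cons s x : Fin (n + 2) → S) = Fin.cons s (Fin.init x) := by
  ext i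
  refine Fin.cases ?_ (fun i => ?_) i <;> simp [Fin.init]

/-! ### Conditioning -/

/-- Cross-multiplied Bayes' rule needs no positivity: on a null event both sides vanish, so the
convention in `condition` is immaterial. -/
theorem Belief.mass_mul_condition {S : Type*} [Fintype S] (ω : Belief S) (E : Set S) (s : S) :
    ω.mass E * ω.condition E s = E.indicator ω s := by
  have h0 : ∀ s, 0 ≤ E.indicator ω s := fun s =>
    Set.indicator_nonneg (fun x _ => stdSimplex.zero_le ω x) s
  unfold Belief.condition
  split_ifs with h
  · rw [h, zero_mul]
    exact ((Finset.sum_eq_zero_iff_of_nonneg fun i _ => h0 i).1 h s (Finset.mem_univ s)).symm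
  · exact mul_div_cancel₀ _ h

theorem Belief.mass_nonneg {S : Type*} [Fintype S] (ω : Belief S) (E : Set S) : 0 ≤ ω.mass E :=
  Finset.sum_nonneg fun s _ => Set.indicator_nonneg (fun x _ => stdSimplex.zero_le ω x) s

theorem sum_indicator_fiber {S O : Type*} [Fintype O] (f : S → O) (g : S → ℝ) (s : S) :
    ∑ o, {s | f s = o}.indicator g s = g s := by
  classical
  simp [Set.indicator_apply]

theorem Belief.sum_mass_fiber {S O : Type*} [Fintype S] [Fintype O] (ω : Belief S) (f : S → O) :
    ∑ o, ω.mass {s | f s = o} = 1 := by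
  unfold Belief.mass
  rw [Finset.sum_comm]
  simp_rw [sum_indicator_fiber]
  exact stdSimplex.sum_eq_one ω

/-! ### Continuations of history policies -/

section

variable {O U : Type*}

/-- The first action of a history policy. -/
def HistoryPolicy.first (π : HistoryPolicy O U) : U := π 0 Fin.elim0

/-- The policy that remains after the first action and the first observation `o`. -/
def HistoryPolicy.continuation (π : HistoryPolicy O U) (o : O) :
    HistoryPolicy O U :=
  fun t h => π (t + 1) (Fin.cons o h)

/-- The policy that starts with `u` and continues with `π o` after the first observation `o`. -/
def HistoryPolicy.prepend (u : U) (π : O → HistoryPolicy O U) :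
    HistoryPolicy O U
  | 0, _ => u
  | t + 1, h => π (h 0) t (Fin.tail h)

end

/-! ### First-step decomposition of paths and rewards. -/

namespace POMDP

variable {S O U : Type*} [Fintype S] (M : POMDP S O U)

/-- The definitions recurse on the last state, the Bellman equation on the first. The initial state
itself is not observed, so the first observation comes from `x 0`, the state at time 1. -/
theorem observations_cons (π : HistoryPolicy O U) (t : ℕ) (s : S) (x : Fin (t + 1) → S) :
    M.observations π (t + 1) (Fin.cons s x) =
      Fin.cons (M.obs (x 0) π.first)
        (M.observations (π.continuation (M.obs (x 0) π.first)) t x) := by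
  induction t with
  | zero =>
    ext i
    fin_cases i
    simp only [observations]
    rfl
  | succ t ih =>
    rw [observations, init_cons, ih, observations, Fin.cons_snoc_eq_snoc_cons]
    rfl

theorem action_cons (π : HistoryPolicy O U) (t : ℕ) (s : S) (x : Fin (t + 1) → S) :
    M.action π (t + 1) (Fin.cons s x) =
      M.action (π.continuation (M.obs (x 0) π.first)) t x := by
  rw [action, observations_cons]
  rfl

/-- The weight of the state path `s₀, …, s_t` under `π`, for the initial weights `w`. -/
def pathWeight (w : S → ℝ) (π : HistoryPolicy O U) : ∀ t : ℕ, (Fin (t + 1) → S) → ℝ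
  | 0, x => w (x 0)
  | t + 1, x =>
      pathWeight w π t (Fin.init x) *
        M.P (x (Fin.last t).castSucc) (M.action π t (Fin.init x)) (x (Fin.last (t + 1)))

theorem pathProb_eq_pathWeight (ω : Belief S) (π : HistoryPolicy O U) (t : ℕ)
    (x : Fin (t + 1) → S) : M.pathProb ω π t x = M.pathWeight ω π t x := by
  induction t with
  | zero => rfl
  | succ t ih => rw [pathProb, pathWeight, ih]

theorem pathWeight_cons (w : S → ℝ) (π : HistoryPolicy O U) (t : ℕ) (s : S)
    (x : Fin (t + 1) → S) :
    M.pathWeight w π (t + 1) (Fin.cons s x) =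
      M.pathWeight (fun s' => w s * M.P s π.first s')
        (π.continuation (M.obs (x 0) π.first)) t x := by
  induction t with
  | zero => rfl
  | succ t ih =>
    rw [pathWeight, init_cons, ih, pathWeight, action_cons]
    rfl

/-- The expected reward at time `t` when the initial state is `s`. -/
def stateReward (π : HistoryPolicy O U) : ℕ → S → ℝ
  | 0, s => M.r s π.first
  | t + 1, s =>
      ∑ s', M.P s π.first s' * stateReward (π.continuation (M.obs s' π.first)) t s'

/-- The policy may depend on the initial state because, after one step, the continuation depends on
the observation and so on the new initial state. The same generality covers split policies, whose
POMDP policy is selected by the first message. -/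
theorem sum_pathWeight_mul_reward (w : S → ℝ) (π : S → HistoryPolicy O U) (t : ℕ) :
    ∑ x : Fin (t + 1) → S,
        M.pathWeight w (π (x 0)) t x * M.r (x (Fin.last t)) (M.action (π (x 0)) t x) =
      ∑ s, w s * M.stateReward (π s) t s := by
  induction t generalizing w π with
  | zero =>
    rw [sum_cons]
    simp [pathWeight, stateReward, action, observations, HistoryPolicy.first]
  | succ t ih =>
    rw [sum_cons]
    refine Finset.sum_congr rfl fun s _ => ?_
    simp only [Fin.cons_zero, pathWeight_cons, action_cons]
    have := ih (fun s' => w s * M.P s (π s).first s')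
      (fun s' => (π s).continuation (M.obs s' (π s).first))
    simp only [← Fin.succ_last, Fin.cons_succ]
    rw [this, stateReward, Finset.mul_sum]
    exact Finset.sum_congr rfl fun s' _ => mul_assoc _ _ _

theorem stageReward_eq (ω : Belief S) (π : HistoryPolicy O U) (t : ℕ) :
    M.stageReward ω π t = ∑ s, ω s * M.stateReward π t s := by
  rw [← M.sum_pathWeight_mul_reward ω (fun _ => π)]
  simp only [stageReward, pathProb_eq_pathWeight]

/-! ### Uniform bounds and convergence of the series. -/

section Bounds

variable [Finite U]

theorem exists_reward_bound : ∃ C : ℝ, ∀ s u, |M.r s u| ≤ C := by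
  cases nonempty_fintype U
  refine ⟨∑ s, ∑ u, |M.r s u|, fun s u => ?_⟩
  calc |M.r s u| ≤ ∑ u, |M.r s u| :=
        Finset.single_le_sum (f := fun u => |M.r s u|) (fun _ _ => abs_nonneg _)
          (Finset.mem_univ u)
    _ ≤ _ := Finset.single_le_sum (f := fun s => ∑ u, |M.r s u|)
          (fun _ _ => Finset.sum_nonneg fun _ _ => abs_nonneg _) (Finset.mem_univ s)

/-- A bound of the rewards. -/
def rewardBound : ℝ := M.exists_reward_bound.choose

theorem abs_stateReward_le (π : HistoryPolicy O U) (t : ℕ) (s : S) :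
    |M.stateReward π t s| ≤ M.rewardBound := by
  induction t generalizing π s with
  | zero => exact M.exists_reward_bound.choose_spec _ _
  | succ t ih =>
    calc |M.stateReward π (t + 1) s|
        ≤ ∑ s', M.P s π.first s' * M.rewardBound := by
          refine (Finset.abs_sum_le_sum_abs _ _).trans (Finset.sum_le_sum fun s' _ => ?_)
          rw [abs_mul, abs_of_nonneg (stdSimplex.zero_le _ s')]
          exact mul_le_mul_of_nonneg_left (ih _ _) (stdSimplex.zero_le _ s')
      _ = M.rewardBound := by rw [← Finset.sum_mul, stdSimplex.sum_eq_one, one_mul]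

theorem summable_geometric_mul {γ C : ℝ} (h0 : 0 ≤ γ) (h1 : γ < 1) {f : ℕ → ℝ}
    (hf : ∀ t, |f t| ≤ C) : Summable fun t => γ ^ t * f t := by
  refine Summable.of_norm_bounded ((summable_geometric_of_lt_one h0 h1).mul_right C) fun t => ?_
  rw [Real.norm_eq_abs, abs_mul, abs_of_nonneg (pow_nonneg h0 t)]
  exact mul_le_mul_of_nonneg_left (hf t) (pow_nonneg h0 t)

theorem summable_stateReward (π : HistoryPolicy O U) (s : S) :
    Summable fun t => M.γ ^ t * M.stateReward π t s :=
  summable_geometric_mul M.γ_nonneg M.γ_lt_one fun t => M.abs_stateReward_le π t s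

theorem hasSum_sum_stateReward (w : S → ℝ) (π : S → HistoryPolicy O U) :
    HasSum (fun t => M.γ ^ t * ∑ s, w s * M.stateReward (π s) t s)
      (∑ s, w s * ∑' t, M.γ ^ t * M.stateReward (π s) t s) := by
  have : (fun t => M.γ ^ t * ∑ s, w s * M.stateReward (π s) t s) =
      fun t => ∑ s, w s * (M.γ ^ t * M.stateReward (π s) t s) := by
    funext t
    rw [Finset.mul_sum]
    exact Finset.sum_congr rfl fun s _ => by ring
  rw [this]
  exact hasSum_sum fun s _ => (M.summable_stateReward (π s) s).hasSum.mul_left _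

theorem summable_stageReward (ω : Belief S) (π : HistoryPolicy O U) :
    Summable fun t => M.γ ^ t * M.stageReward ω π t := by
  simp_rw [stageReward_eq]
  exact (M.hasSum_sum_stateReward ω fun _ => π).summable

end Bounds

/-! ### Values as functions of unnormalized weights. -/

/-- The expected discounted reward when the initial state is `s`. -/
def stateValue (π : HistoryPolicy O U) (s : S) : ℝ := ∑' t, M.γ ^ t * M.stateReward π t s

/-- The expected discounted reward for the initial weights `w`. -/
def linearValue (w : S → ℝ) (π : HistoryPolicy O U) : ℝ := ∑ s, w s * M.stateValue π s

/-- The unnormalized belief update. -/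
def weightUpdate (w : S → ℝ) (u : U) (o : O) : S → ℝ :=
  {s' | M.obs s' u = o}.indicator fun s' => ∑ s, w s * M.P s u s'

theorem weightUpdate_eq (ω : Belief S) (u : U) (o : O) :
    M.weightUpdate ω u o =
      (ω.predict fun s => M.P s u).mass {s' | M.obs s' u = o} • ⇑(M.beliefUpdate ω u o) := by
  ext s
  exact (Belief.mass_mul_condition (ω.predict fun s => M.P s u) {s' | M.obs s' u = o} s).symm

/-- The optimal expected discounted reward for the initial weights `w`. -/
def optimalValue (w : S → ℝ) : ℝ := ⨆ π : HistoryPolicy O U, M.linearValue w π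

/-- Homogeneity is what allows passing between beliefs and unnormalized weights. -/
theorem optimalValue_smul {c : ℝ} (hc : 0 ≤ c) (w : S → ℝ) :
    M.optimalValue (c • w) = c * M.optimalValue w := by
  unfold optimalValue
  rw [Real.mul_iSup_of_nonneg hc]
  simp [linearValue, Finset.mul_sum, mul_assoc]

/-- The expected discounted reward of the action `u` at the initial weights `w`, when the
continuation is optimal. -/
def actionValue [Fintype O] (w : S → ℝ) (u : U) : ℝ :=
  ∑ s, w s * M.r s u + M.γ * ∑ o, M.optimalValue (M.weightUpdate w u o)

theorem actionValue_eq [Fintype O] (ω : Belief S) (u : U) :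
    M.actionValue ω u = ∑ s, ω s * M.r s u +
      M.γ * ∑ o, (ω.predict fun s => M.P s u).mass {s' | M.obs s' u = o} *
        M.optimalValue (M.beliefUpdate ω u o) := by
  unfold actionValue
  simp_rw [weightUpdate_eq, M.optimalValue_smul (Belief.mass_nonneg _ _)]

section Value

variable [Finite U]

theorem value_eq_linearValue (ω : Belief S) (π : HistoryPolicy O U) :
    M.value ω π = M.linearValue ω π := by
  unfold value linearValue
  simp_rw [stageReward_eq]
  exact (M.hasSum_sum_stateReward ω fun _ => π).tsum_eq

/-- A bound of the values. -/
def valueBound : ℝ := M.rewardBound * (1 - M.γ)⁻¹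

theorem abs_stateValue_le (π : HistoryPolicy O U) (s : S) :
    |M.stateValue π s| ≤ M.valueBound := by
  have h := (hasSum_geometric_of_lt_one M.γ_nonneg M.γ_lt_one).mul_left M.rewardBound
  refine tsum_of_norm_bounded (f := fun t => M.γ ^ t * M.stateReward π t s) h fun t => ?_
  rw [Real.norm_eq_abs, abs_mul, abs_of_nonneg (pow_nonneg M.γ_nonneg t), mul_comm]
  exact mul_le_mul_of_nonneg_right (M.abs_stateReward_le π t s) (pow_nonneg M.γ_nonneg t)

theorem abs_linearValue_le (w : S → ℝ) (π : HistoryPolicy O U) :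
    |M.linearValue w π| ≤ (∑ s, |w s|) * M.valueBound := by
  rw [Finset.sum_mul]
  refine (Finset.abs_sum_le_sum_abs _ _).trans (Finset.sum_le_sum fun s _ => ?_)
  rw [abs_mul]
  exact mul_le_mul_of_nonneg_left (M.abs_stateValue_le π s) (abs_nonneg _)

theorem stateValue_eq (π : HistoryPolicy O U) (s : S) :
    M.stateValue π s = M.r s π.first + M.γ * ∑ s', M.P s π.first s' *
      M.stateValue (π.continuation (M.obs s' π.first)) s' := by
  have h := M.hasSum_sum_stateReward (M.P s π.first)
    fun s' => π.continuation (M.obs s' π.first)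
  rw [stateValue, (M.summable_stateReward π s).tsum_eq_zero_add]
  simp only [pow_zero, one_mul, stateReward]
  congr 1
  simp_rw [pow_succ', mul_assoc]
  rw [tsum_mul_left]
  exact congrArg _ h.tsum_eq

theorem linearValue_eq [Fintype O] (w : S → ℝ) (π : HistoryPolicy O U) :
    M.linearValue w π = ∑ s, w s * M.r s π.first +
      M.γ * ∑ o, M.linearValue (M.weightUpdate w π.first o) (π.continuation o) := by
  -- The state `s'` determines the observation, so exactly one `o` contributes.
  have : ∀ s', ∑ o, M.weightUpdate w π.first o s' * M.stateValue (π.continuation o) s' =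
      (∑ s, w s * M.P s π.first s') *
        M.stateValue (π.continuation (M.obs s' π.first)) s' := by
    intro s'
    classical
    simp [weightUpdate, Set.indicator_apply]
  unfold linearValue
  rw [Finset.sum_comm (γ := O)]
  simp_rw [this, Finset.sum_mul]
  rw [Finset.sum_comm, Finset.mul_sum, ← Finset.sum_add_distrib]
  refine Finset.sum_congr rfl fun s _ => ?_
  rw [stateValue_eq, mul_add, Finset.mul_sum, Finset.mul_sum, Finset.mul_sum]
  congr 1
  exact Finset.sum_congr rfl fun s' _ => by ring

/-! ### The optimality equation -/

theorem bddAbove_linearValue (w : S → ℝ) :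
    BddAbove (Set.range fun π : HistoryPolicy O U => M.linearValue w π) :=
  ⟨(∑ s, |w s|) * M.valueBound, by
    rintro _ ⟨π, rfl⟩
    exact (le_abs_self _).trans (M.abs_linearValue_le w π)⟩

theorem linearValue_le_optimalValue (w : S → ℝ) (π : HistoryPolicy O U) :
    M.linearValue w π ≤ M.optimalValue w :=
  le_ciSup (M.bddAbove_linearValue w) π

variable [Nonempty U]

theorem abs_optimalValue_le (w : S → ℝ) :
    |M.optimalValue w| ≤ (∑ s, |w s|) * M.valueBound := by
  have : Nonempty (HistoryPolicy O U) := ⟨fun _ _ => Classical.arbitrary U⟩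
  let π : HistoryPolicy O U := fun _ _ => Classical.arbitrary U
  rw [abs_le]
  exact ⟨(neg_le_of_abs_le (M.abs_linearValue_le w π)).trans (M.linearValue_le_optimalValue w π),
    ciSup_le fun π => (le_abs_self _).trans (M.abs_linearValue_le w π)⟩

theorem optimalValue_add_le (v w : S → ℝ) :
    M.optimalValue (v + w) ≤ M.optimalValue v + M.optimalValue w := by
  have : Nonempty (HistoryPolicy O U) := ⟨fun _ _ => Classical.arbitrary U⟩
  refine ciSup_le fun π => ?_
  have : M.linearValue (v + w) π = M.linearValue v π + M.linearValue w π := by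
    simp [linearValue, add_mul, Finset.sum_add_distrib]
  rw [this]
  exact add_le_add (M.linearValue_le_optimalValue v π) (M.linearValue_le_optimalValue w π)

theorem convexOn_optimalValue : ConvexOn ℝ Set.univ M.optimalValue :=
  ⟨convex_univ, fun v _ w _ a b ha hb _ => by
    refine (M.optimalValue_add_le _ _).trans ?_
    rw [M.optimalValue_smul ha, M.optimalValue_smul hb]
    rfl⟩

variable [Fintype O]

/-- Near-optimal continuations, one per observation, are glued after `u`; the supremum is not yet
known to be attained. -/
theorem actionValue_le_optimalValue (w : S → ℝ) (u : U) :
    M.actionValue w u ≤ M.optimalValue w := by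
  have : Nonempty (HistoryPolicy O U) := ⟨fun _ _ => Classical.arbitrary U⟩
  refine le_of_forall_pos_lt_add fun ε hε => ?_
  -- The `+ 1` keeps the denominator positive and makes the total loss `card O * δ` strictly less
  -- than `ε`.
  set δ := ε / (Fintype.card O + 1) with hδ
  have hδ0 : 0 < δ := by positivity
  choose π hπ using fun o => exists_lt_of_lt_ciSup
    (show M.optimalValue (M.weightUpdate w u o) - δ <
      ⨆ π : HistoryPolicy O U, M.linearValue (M.weightUpdate w u o) π from sub_lt_self _ hδ0)
  have h1 := M.linearValue_le_optimalValue w (HistoryPolicy.prepend u π)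
  rw [linearValue_eq] at h1
  have h2 : ∑ o, (M.optimalValue (M.weightUpdate w u o) - δ) ≤
      ∑ o, M.linearValue (M.weightUpdate w u o) (π o) := Finset.sum_le_sum fun o _ => (hπ o).le
  rw [Finset.sum_sub_distrib, Finset.sum_const, Finset.card_univ, nsmul_eq_mul] at h2
  have h3 : Fintype.card O * δ < ε := by
    have : (Fintype.card O + 1) * δ = ε := by rw [hδ]; field_simp
    linarith
  have h4 := mul_le_mul_of_nonneg_left h2 M.γ_nonneg
  have h5 : M.γ * (Fintype.card O * δ) ≤ 1 * (Fintype.card O * δ) :=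
    mul_le_mul_of_nonneg_right M.γ_lt_one.le (by positivity)
  change ∑ s, w s * M.r s u + M.γ * ∑ o, M.linearValue (M.weightUpdate w u o) (π o) ≤ _ at h1
  unfold actionValue
  linarith

/-- Any history policy is bounded by the action value of its first action, and a finite action set
has a maximizer. -/
theorem exists_optimalValue_eq_actionValue (w : S → ℝ) :
    ∃ u, M.optimalValue w = M.actionValue w u := by
  have : Nonempty (HistoryPolicy O U) := ⟨fun _ _ => Classical.arbitrary U⟩
  obtain ⟨u, hu⟩ := Finite.exists_max fun u => M.actionValue w u
  refine ⟨u, le_antisymm (ciSup_le fun π => ?_) (M.actionValue_le_optimalValue w u)⟩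
  rw [linearValue_eq]
  refine le_trans ?_ (hu π.first)
  exact add_le_add_right (mul_le_mul_of_nonneg_left
    (Finset.sum_le_sum fun o _ => M.linearValue_le_optimalValue _ _) M.γ_nonneg) _

/-- A belief policy that is greedy for the optimal value. -/
def greedy : BeliefPolicy S U := fun ω => (M.exists_optimalValue_eq_actionValue ω).choose

theorem optimalValue_eq_actionValue_greedy (ω : Belief S) :
    M.optimalValue ω = M.actionValue ω (M.greedy ω) :=
  (M.exists_optimalValue_eq_actionValue ω).choose_spec

end Value

/-! ### Evaluation of belief policies and optimality of the greedy one. -/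

theorem continuation_ofBeliefPolicy (ω : Belief S) (π : BeliefPolicy S U) (o : O) :
    (M.ofBeliefPolicy ω π).continuation o = M.ofBeliefPolicy (M.beliefUpdate ω (π ω) o) π := by
  have h : ∀ (t : ℕ) (h : Fin t → O),
      M.belief ω π (t + 1) (Fin.cons o h) = M.belief (M.beliefUpdate ω (π ω) o) π t h := by
    intro t
    induction t with
    | zero => intro h; rfl
    | succ t ih =>
      intro h
      rw [belief, init_cons, ih, belief]
      rfl
  funext t x
  exact congrArg π (h t x)

section Greedy

variable [Finite U] [Fintype O]

theorem beliefValue_eq (ω : Belief S) (π : BeliefPolicy S U) :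
    M.beliefValue ω π = ∑ s, ω s * M.r s (π ω) +
      M.γ * ∑ o, (ω.predict fun s => M.P s (π ω)).mass {s' | M.obs s' (π ω) = o} *
        M.beliefValue (M.beliefUpdate ω (π ω) o) π := by
  rw [beliefValue, value_eq_linearValue, linearValue_eq]
  refine congrArg₂ _ rfl (congrArg _ (Finset.sum_congr rfl fun o _ => ?_))
  change M.linearValue (M.weightUpdate ω (π ω) o) _ = _
  rw [weightUpdate_eq, continuation_ofBeliefPolicy, beliefValue, value_eq_linearValue]
  simp [linearValue, Finset.mul_sum, mul_assoc]

variable [Nonempty U]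

theorem beliefValue_greedy (ω : Belief S) :
    M.beliefValue ω M.greedy = M.optimalValue ω := by
  have hω : ∀ ω : Belief S, ∑ s, |ω s| = 1 := fun ω => by
    simp_rw [abs_of_nonneg (stdSimplex.zero_le ω _)]
    exact stdSimplex.sum_eq_one ω
  -- Both functions satisfy the same one-step recursion along `greedy`; since the observation masses
  -- sum to 1, each step shrinks their uniform distance by `γ`.
  have bound : ∀ (n : ℕ) (ω : Belief S),
      |M.optimalValue ω - M.beliefValue ω M.greedy| ≤ M.γ ^ n * (2 * M.valueBound) := by
    intro n
    induction n with
    | zero =>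
      intro ω
      have h1 := M.abs_optimalValue_le ω
      have h2 := M.abs_linearValue_le ω (M.ofBeliefPolicy ω M.greedy)
      rw [hω, one_mul] at h1 h2
      rw [beliefValue, value_eq_linearValue, pow_zero, one_mul, two_mul]
      exact (abs_sub _ _).trans (add_le_add h1 h2)
    | succ n ih =>
      intro ω
      rw [optimalValue_eq_actionValue_greedy, actionValue_eq, beliefValue_eq,
        add_sub_add_left_eq_sub, ← mul_sub, abs_mul, abs_of_nonneg M.γ_nonneg, pow_succ',
        mul_assoc]
      refine mul_le_mul_of_nonneg_left ?_ M.γ_nonneg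
      rw [← Finset.sum_sub_distrib]
      calc _ ≤ ∑ o, (ω.predict fun s => M.P s (M.greedy ω)).mass
              {s' | M.obs s' (M.greedy ω) = o} * (M.γ ^ n * (2 * M.valueBound)) := by
            refine (Finset.abs_sum_le_sum_abs _ _).trans (Finset.sum_le_sum fun o _ => ?_)
            rw [← mul_sub, abs_mul, abs_of_nonneg (Belief.mass_nonneg _ _)]
            exact mul_le_mul_of_nonneg_left (ih _) (Belief.mass_nonneg _ _)
        _ = _ := by rw [← Finset.sum_mul, Belief.sum_mass_fiber, one_mul]
  have lim := (tendsto_pow_atTop_nhds_zero_of_lt_one M.γ_nonneg M.γ_lt_one).mul_const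
    (2 * M.valueBound)
  rw [zero_mul] at lim
  have := ge_of_tendsto' lim fun n => bound n ω
  exact (sub_eq_zero.1 (abs_nonpos_iff.1 this)).symm

theorem value_le_beliefValue_greedy (ω : Belief S) (π : HistoryPolicy O U) :
    M.value ω π ≤ M.beliefValue ω M.greedy := by
  rw [beliefValue_greedy, value_eq_linearValue]
  exact M.linearValue_le_optimalValue _ _

theorem isOptimalBeliefPolicy_greedy (ω : Belief S) : M.IsOptimalBeliefPolicy ω M.greedy :=
  fun _ => M.value_le_beliefValue_greedy _ _

theorem IsOptimalBeliefPolicy.value_le {M : POMDP S O U} {ω : Belief S} {π : BeliefPolicy S U}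
    (h : M.IsOptimalBeliefPolicy ω π) (π' : HistoryPolicy O U) :
    M.value ω π' ≤ M.beliefValue ω π :=
  (M.value_le_beliefValue_greedy ω π').trans (h _)

end Greedy

end POMDP

open POMDP

namespace Model

/-! ### Splitting is a bijection -/

section Bijection

variable {S A : Type*}

theorem split_injective : Function.Injective fun p : (S → Bool) ×
    (Option S → HistoryPolicy (Option S) (A × (S → Bool))) => split p.1 p.2 := by
  rintro ⟨e, π⟩ ⟨e', π'⟩ h
  have he := congrArg JointPolicy.enc h
  have hd := congrArg JointPolicy.dec h
  refine Prod.ext ?_ ?_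
  · funext s
    exact congrFun (congrFun (congrFun he 0) fun _ => s) Fin.elim0
  · funext o t x
    refine Prod.ext ?_ ?_
    · exact congrFun (congrFun hd t) (Fin.cons o x)
    · funext s
      exact congrFun (congrFun (congrFun he (t + 1)) fun _ => s) (Fin.cons o x)

theorem range_split : (Set.range fun p : (S → Bool) ×
    (Option S → HistoryPolicy (Option S) (A × (S → Bool))) => split p.1 p.2) =
      {π | π.IsReduced} := by
  ext π
  constructor
  · rintro ⟨⟨e, π⟩, rfl⟩ t x x' o h
    cases t with
    | zero => exact congrArg e h
    | succ t => exact congrArg (π (o 0) t (Fin.tail o)).2 h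
  · intro h
    -- For a reduced encoder, the constant path at the current state can stand in for any state
    -- history.
    refine ⟨(fun s => π.enc 0 (fun _ => s) Fin.elim0, fun o t x =>
      (π.dec t (Fin.cons o x), fun s => π.enc (t + 1) (fun _ => s) (Fin.cons o x))), ?_⟩
    cases π with
    | mk enc dec =>
      refine JointPolicy.mk.injEq .. |>.mpr ⟨?_, ?_⟩
      · funext t x o
        cases t with
        | zero =>
          rw [Subsingleton.elim o Fin.elim0]
          exact h 0 (fun _ => x 0) x Fin.elim0 rfl
        | succ t =>
          simp only [Fin.cons_self_tail]
          exact h (t + 1) (fun _ => x (Fin.last (t + 1))) x o rfl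
      · funext t o
        simp only [Fin.cons_self_tail]

end Bijection

variable {S A : Type*} [Fintype S] (M : Model S A)

/-! ### Path sums of the push-based problem -/

theorem pathProb_nonneg (μ : Belief S) (π : JointPolicy S A) (t : ℕ) (x : Fin (t + 1) → S) :
    0 ≤ M.pathProb μ π t x := by
  induction t with
  | zero => exact stdSimplex.zero_le μ _
  | succ t ih => exact mul_nonneg (ih _) (stdSimplex.zero_le _ _)

theorem pathProb_snoc (μ : Belief S) (π : JointPolicy S A) (t : ℕ) (x : Fin (t + 1) → S) (s : S) :
    M.pathProb μ π (t + 1) (Fin.snoc x s) =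
      M.pathProb μ π t x * M.P (x (Fin.last t)) (π.control t x) s := by
  simp [pathProb]

theorem sum_pathProb (μ : Belief S) (π : JointPolicy S A) (t : ℕ) :
    ∑ x, M.pathProb μ π t x = 1 := by
  induction t with
  | zero =>
    rw [sum_cons]
    simp [pathProb]
  | succ t ih =>
    rw [sum_snoc, ← ih]
    refine Finset.sum_congr rfl fun x _ => ?_
    simp_rw [pathProb_snoc, ← Finset.mul_sum, stdSimplex.sum_eq_one, mul_one]

/-- The expected number of transmissions at time `t`. -/
def commRate (μ : Belief S) (π : JointPolicy S A) (t : ℕ) : ℝ :=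
  ∑ x : Fin (t + 1) → S, M.pathProb μ π t x * cost (π.comm t x)

/-- The expectation of `r_t - γ β c_{t+1}`. -/
def shiftedReward (μ : Belief S) (π : JointPolicy S A) (t : ℕ) : ℝ :=
  ∑ x : Fin (t + 1) → S, M.pathProb μ π t x *
    ∑ s, M.P (x (Fin.last t)) (π.control t x) s *
      (M.r (x (Fin.last t)) (π.control t x) s
        - M.γ * M.β * cost (π.comm (t + 1) (Fin.snoc x s)))

theorem stageReward_sub (μ : Belief S) (π : JointPolicy S A) (t : ℕ) :
    M.stageReward μ π t =
      M.shiftedReward μ π t + M.γ * M.β * M.commRate μ π (t + 1) - M.β * M.commRate μ π t := by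
  have hc : M.commRate μ π (t + 1) = ∑ x : Fin (t + 1) → S, ∑ s,
      M.pathProb μ π (t + 1) (Fin.snoc x s) * cost (π.comm (t + 1) (Fin.snoc x s)) := by
    rw [commRate, sum_snoc]
  rw [hc, stageReward, sum_snoc, shiftedReward, commRate, Finset.mul_sum, Finset.mul_sum,
    ← Finset.sum_add_distrib, ← Finset.sum_sub_distrib]
  refine Finset.sum_congr rfl fun x _ => ?_
  have h := stdSimplex.sum_eq_one (M.P (x (Fin.last t)) (π.control t x))
  -- The cost of `c_t` does not depend on the next state; spreading it over the transition law
  -- allows a termwise comparison.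
  have : M.β * (M.pathProb μ π t x * cost (π.comm t x)) =
      ∑ s, M.β * (M.pathProb μ π t x * cost (π.comm t x)) *
        M.P (x (Fin.last t)) (π.control t x) s := by
    rw [← Finset.mul_sum, h, mul_one]
  rw [this, Finset.mul_sum, Finset.mul_sum, ← Finset.sum_add_distrib, ← Finset.sum_sub_distrib]
  refine Finset.sum_congr rfl fun s _ => ?_
  simp only [pathProb_snoc, Fin.snoc_castSucc, Fin.snoc_last, Fin.init_snoc]
  ring

theorem abs_commRate_le (μ : Belief S) (π : JointPolicy S A) (t : ℕ) :
    |M.commRate μ π t| ≤ 1 := by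
  have hc : ∀ c, |cost c| ≤ 1 := fun c => by cases c <;> simp [cost]
  rw [← M.sum_pathProb μ π t]
  refine (Finset.abs_sum_le_sum_abs _ _).trans (Finset.sum_le_sum fun x _ => ?_)
  rw [abs_mul, abs_of_nonneg (M.pathProb_nonneg μ π t x)]
  exact mul_le_of_le_one_right (M.pathProb_nonneg μ π t x) (hc _)

section Finite

variable [Finite A]

theorem exists_abs_stageReward_le :
    ∃ C : ℝ, ∀ (μ : Belief S) (π : JointPolicy S A) (t : ℕ), |M.stageReward μ π t| ≤ C := by
  cases nonempty_fintype A
  obtain ⟨C, hC⟩ := (Set.finite_range fun p : S × A × S × Bool =>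
    |M.r p.1 p.2.1 p.2.2.1 - M.β * cost p.2.2.2|).bddAbove
  refine ⟨C, fun μ π t => ?_⟩
  rw [← one_mul C, ← M.sum_pathProb μ π (t + 1), Finset.sum_mul]
  refine (Finset.abs_sum_le_sum_abs _ _).trans (Finset.sum_le_sum fun x _ => ?_)
  rw [abs_mul, abs_of_nonneg (M.pathProb_nonneg μ π _ x)]
  exact mul_le_mul_of_nonneg_left (hC ⟨(_, _, _, _), rfl⟩) (M.pathProb_nonneg μ π _ x)

theorem summable_stageReward (μ : Belief S) (π : JointPolicy S A) :
    Summable fun t => M.γ ^ t * M.stageReward μ π t := by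
  obtain ⟨C, hC⟩ := M.exists_abs_stageReward_le
  exact summable_geometric_mul M.γ_nonneg M.γ_lt_one (hC μ π)

/-- The shifted communication costs cancel between consecutive times; only that of `c_0` is left. -/
theorem hasSum_shiftedReward (μ : Belief S) (π : JointPolicy S A) :
    HasSum (fun t => M.γ ^ t * M.shiftedReward μ π t)
      (M.objective μ π + M.β * M.commRate μ π 0) := by
  have hc : Summable fun t => M.γ ^ t * M.commRate μ π t :=
    summable_geometric_mul M.γ_nonneg M.γ_lt_one (M.abs_commRate_le μ π)
  have h0 := hc.hasSum
  have h1 := (hasSum_nat_add_iff' 1).2 h0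
  have h := ((M.summable_stageReward μ π).hasSum.add (h0.mul_left M.β)).sub (h1.mul_left M.β)
  have e1 : (fun t => M.γ ^ t * M.shiftedReward μ π t) = fun t =>
      M.γ ^ t * M.stageReward μ π t + M.β * (M.γ ^ t * M.commRate μ π t)
        - M.β * (M.γ ^ (t + 1) * M.commRate μ π (t + 1)) := by
    funext t
    rw [stageReward_sub]
    ring
  have e2 : M.objective μ π + M.β * M.commRate μ π 0 =
      ∑' t, M.γ ^ t * M.stageReward μ π t + M.β * ∑' t, M.γ ^ t * M.commRate μ π t -
        M.β * (∑' t, M.γ ^ t * M.commRate μ π t -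
          ∑ i ∈ Finset.range 1, M.γ ^ i * M.commRate μ π i) := by
    rw [objective, Finset.sum_range_one]
    ring
  rw [e1, e2]
  exact h

end Finite

/-! ### The objective of a split policy -/

section Split

variable (e₀ : S → Bool) (π : Option S → HistoryPolicy (Option S) (A × (S → Bool)))

/-- The first message only selects the POMDP policy; the later ones are exactly its observations. -/
theorem messages_split (t : ℕ) (x : Fin (t + 1) → S) :
    (split e₀ π).messages (t + 1) x =
      Fin.cons (message (x 0) (e₀ (x 0)))
        (M.jointPOMDP.observations (π (message (x 0) (e₀ (x 0)))) t x) := by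
  induction t with
  | zero =>
    ext1 i
    fin_cases i
    rfl
  | succ t ih =>
    rw [JointPolicy.messages, ih, observations, Fin.cons_snoc_eq_snoc_cons]
    rfl

theorem control_split (t : ℕ) (x : Fin (t + 1) → S) :
    (split e₀ π).control t x =
      (M.jointPOMDP.action (π (message (x 0) (e₀ (x 0)))) t x).1 := by
  rw [JointPolicy.control, M.messages_split]
  rfl

theorem comm_split_succ (t : ℕ) (x : Fin (t + 1) → S) (s : S) :
    (split e₀ π).comm (t + 1) (Fin.snoc x s) =
      (M.jointPOMDP.action (π (message (x 0) (e₀ (x 0)))) t x).2 s := by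
  rw [JointPolicy.comm, Fin.init_snoc, M.messages_split]
  simp [split, action]

theorem pathProb_split (μ : Belief S) (t : ℕ) (x : Fin (t + 1) → S) :
    M.pathProb μ (split e₀ π) t x =
      M.jointPOMDP.pathWeight μ (π (message (x 0) (e₀ (x 0)))) t x := by
  induction t with
  | zero => rfl
  | succ t ih =>
    rw [pathProb, ih, control_split, pathWeight]
    rfl

theorem shiftedReward_split (μ : Belief S) (t : ℕ) :
    M.shiftedReward μ (split e₀ π) t =
      ∑ s, μ s * M.jointPOMDP.stateReward (π (message s (e₀ s))) t s := by
  rw [← sum_pathWeight_mul_reward _ _ fun s => π (message s (e₀ s))]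
  refine Finset.sum_congr rfl fun x _ => ?_
  simp only [pathProb_split, M.control_split, M.comm_split_succ]
  rfl

theorem commRate_zero (μ : Belief S) (π : JointPolicy S A) :
    M.commRate μ π 0 = ∑ s, μ s * cost (π.enc 0 (fun _ => s) Fin.elim0) := by
  rw [commRate, sum_cons]
  refine Finset.sum_congr rfl fun s _ => ?_
  rw [Fintype.sum_subsingleton _ Fin.elim0]
  have : (Fin.cons s Fin.elim0 : Fin 1 → S) = fun _ => s := by
    funext i
    fin_cases i
    rfl
  rw [this]
  rfl

theorem mass_mul_value_initialBelief [Finite A] (μ : Belief S) (o : Option S)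
    (π : HistoryPolicy (Option S) (A × (S → Bool))) :
    μ.mass {s | message s (e₀ s) = o} * M.jointPOMDP.value (initialBelief μ e₀ o) π =
      M.jointPOMDP.linearValue ({s | message s (e₀ s) = o}.indicator μ) π := by
  rw [value_eq_linearValue, linearValue, linearValue, Finset.mul_sum]
  refine Finset.sum_congr rfl fun s _ => ?_
  rw [← mul_assoc, initialBelief, Belief.mass_mul_condition]

theorem sum_mul_message (μ : Belief S) (f : Option S → ℝ) :
    ∑ s, μ s * f (message s (e₀ s)) = ∑ o, μ.mass {s | message s (e₀ s) = o} * f o := by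
  classical
  unfold Belief.mass
  simp_rw [Finset.sum_mul]
  rw [Finset.sum_comm]
  simp [Set.indicator_apply]

theorem pomdpObjective_eq (μ : Belief S) :
    M.pomdpObjective μ e₀ π =
      ∑ o, μ.mass {s | message s (e₀ s) = o} *
        M.jointPOMDP.value (initialBelief μ e₀ o) (π o) - M.β * ∑ s, μ s * cost (e₀ s) := by
  rw [pomdpObjective, ← sum_mul_message e₀ μ
    fun o => M.jointPOMDP.value (initialBelief μ e₀ o) (π o), Finset.mul_sum,
    ← Finset.sum_sub_distrib]
  exact Finset.sum_congr rfl fun s _ => by ring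

theorem objective_split [Finite A] (μ : Belief S) :
    M.objective μ (split e₀ π) = M.pomdpObjective μ e₀ π := by
  have h1 := M.hasSum_shiftedReward μ (split e₀ π)
  simp_rw [shiftedReward_split] at h1
  have h2 := h1.unique (M.jointPOMDP.hasSum_sum_stateReward μ fun s => π (message s (e₀ s)))
  have h3 : ∑ o, μ.mass {s | message s (e₀ s) = o} *
      M.jointPOMDP.value (initialBelief μ e₀ o) (π o) =
      ∑ s, μ s * M.jointPOMDP.stateValue (π (message s (e₀ s))) s := by
    classical
    simp_rw [mass_mul_value_initialBelief, linearValue]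
    rw [Finset.sum_comm]
    simp [Set.indicator_apply]
  rw [pomdpObjective_eq, h3]
  rw [commRate_zero] at h2
  change M.objective μ (split e₀ π) + M.β * ∑ s, μ s * cost (e₀ s) =
    ∑ s, μ s * M.jointPOMDP.stateValue (π (message s (e₀ s))) s at h2
  linarith

end Split

/-! ### Randomized prescriptions -/

section Prescription

/-- After a transmission the state is known, so the value is linear in the transmitted weight. -/
theorem optimalValue_single [DecidableEq S] {c : ℝ} (hc : 0 ≤ c) (s : S) :
    M.jointPOMDP.optimalValue (Pi.single s c) =
      c * M.jointPOMDP.optimalValue (Pi.single s 1) := by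
  rw [← M.jointPOMDP.optimalValue_smul hc, ← Pi.single_smul]
  simp

theorem actionValue_jointPOMDP [DecidableEq S] (w : S → ℝ) (a : A) (c : S → Bool) :
    M.jointPOMDP.actionValue w (a, c) =
      ∑ s, w s * ∑ s', M.P s a s' * (M.r s a s' - M.γ * M.β * cost (c s')) +
      M.γ * (M.jointPOMDP.optimalValue
          (fun s' => if c s' then 0 else ∑ s, w s * M.P s a s') +
        ∑ s', M.jointPOMDP.optimalValue
          (Pi.single s' (if c s' then ∑ s, w s * M.P s a s' else 0))) := by
  rw [actionValue, Fintype.sum_option]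
  refine congrArg₂ _ rfl (congrArg _ (congrArg₂ _ (congrArg _ ?_)
    (Finset.sum_congr rfl fun s' _ => congrArg _ ?_)))
  · ext s'
    simp only [weightUpdate, Set.indicator_apply, Set.mem_ofPred_eq, jointPOMDP, message]
    by_cases h : c s' = true <;> simp [h]
  · ext y
    simp only [weightUpdate, Set.indicator_apply, Set.mem_ofPred_eq, jointPOMDP, message]
    by_cases hy : y = s'
    · subst hy
      by_cases h : c y = true <;> simp [h]
    · by_cases h : c y = true <;> simp [h, hy]

variable [Finite A] [Nonempty A]

/-- A randomized prescription, which leaves the weights `v` without a transmission, does not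
improve on the optimal value. -/
theorem randomized_le_optimalValue [DecidableEq S] (w v : S → ℝ) (a : A)
    (hv0 : ∀ s', 0 ≤ v s') (hv1 : ∀ s', v s' ≤ ∑ s, w s * M.P s a s') :
    ∑ s, w s * ∑ s', M.P s a s' * M.r s a s' -
        M.γ * M.β * ∑ s', (∑ s, w s * M.P s a s' - v s') +
      M.γ * (M.jointPOMDP.optimalValue v +
        ∑ s', M.jointPOMDP.optimalValue (Pi.single s' (∑ s, w s * M.P s a s' - v s'))) ≤
      M.jointPOMDP.optimalValue w := by
  set n : S → ℝ := fun s' => ∑ s, w s * M.P s a s' with hn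
  have hn0 : ∀ s', 0 ≤ n s' := fun s' => (hv0 s').trans (hv1 s')
  -- The gain per unit of transmitted weight. The price in the reward is `γ β`; it becomes `β` once
  -- the common factor `γ` is taken out.
  set k : S → ℝ := fun s' => M.jointPOMDP.optimalValue (Pi.single s' 1) - M.β with hk
  let F : (S → ℝ) → ℝ := fun y => M.jointPOMDP.optimalValue y + ∑ s', (n s' - y s') * k s'
  have hF : ConvexOn ℝ Set.univ F := by
    refine M.jointPOMDP.convexOn_optimalValue.add ⟨convex_univ, fun x _ y _ a b _ _ hab => ?_⟩
    refine le_of_eq ?_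
    simp only [smul_eq_mul, Finset.mul_sum, ← Finset.sum_add_distrib]
    refine Finset.sum_congr rfl fun s' _ => ?_
    simp only [Pi.add_apply, Pi.smul_apply, smul_eq_mul]
    linear_combination (-(n s' * k s')) * hab
  -- The box of admissible untransmitted weights is the convex hull of its vertices.
  have hmem : v ∈ convexHull ℝ (Set.univ.pi fun s' => ({0, n s'} : Set ℝ)) := by
    rw [convexHull_pi]
    intro s' _
    simp only [convexHull_pair]
    rw [segment_eq_Icc (hn0 s')]
    exact ⟨hv0 s', hv1 s'⟩
  obtain ⟨y, hy, hle⟩ := hF.exists_ge_of_mem_convexHull (Set.subset_univ _) hmem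
  have hy' : ∀ s', y s' = 0 ∨ y s' = n s' := fun s' => hy s' (Set.mem_univ _)
  classical
  -- The vertex `y` read as a prescription: transmit where `y` vanishes, except where `n` vanishes
  -- too and the choice is immaterial.
  let c : S → Bool := fun s' => decide (y s' ≠ n s')
  have hc0 : ∀ s', (if c s' then 0 else n s') = y s' := fun s' => by
    by_cases h : y s' = n s'
    · simp [c, h]
    · rw [if_pos (decide_eq_true h), (hy' s').resolve_right h]
  have hc1 : ∀ s', (if c s' then n s' else 0) = n s' - y s' := fun s' => by
    rw [← hc0]
    cases c s' <;> simp
  have hy1 : ∀ s', 0 ≤ n s' - y s' := fun s' => by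
    rcases hy' s' with h | h <;> simp [h, hn0]
  -- The part of the Bellman expression that depends on the untransmitted weights is `γ * F`; this
  -- is used at both `v` and the vertex `y`.
  have key : ∀ z : S → ℝ, (∀ s', 0 ≤ n s' - z s') →
      - (M.γ * M.β * ∑ s', (n s' - z s')) + M.γ * (M.jointPOMDP.optimalValue z +
        ∑ s', M.jointPOMDP.optimalValue (Pi.single s' (n s' - z s'))) = M.γ * F z := by
    intro z hz
    have : ∑ s', M.jointPOMDP.optimalValue (Pi.single s' (n s' - z s')) =
        ∑ s', (n s' - z s') * k s' + M.β * ∑ s', (n s' - z s') := by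
      rw [Finset.mul_sum, ← Finset.sum_add_distrib]
      refine Finset.sum_congr rfl fun s' _ => ?_
      rw [M.optimalValue_single (hz s'), hk]
      ring
    rw [this]
    ring
  have hb := M.jointPOMDP.actionValue_le_optimalValue w (a, c)
  rw [actionValue_jointPOMDP] at hb
  change _ + M.γ * (M.jointPOMDP.optimalValue (fun s' => if c s' then 0 else n s') +
    ∑ s', M.jointPOMDP.optimalValue (Pi.single s' (if c s' then n s' else 0))) ≤ _ at hb
  simp_rw [hc0, hc1] at hb
  have hcost : ∑ s, w s * ∑ s', M.P s a s' * (M.r s a s' - M.γ * M.β * cost (c s')) =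
      ∑ s, w s * ∑ s', M.P s a s' * M.r s a s' - M.γ * M.β * ∑ s', (n s' - y s') := by
    have : ∀ s', n s' - y s' = ∑ s, w s * M.P s a s' * cost (c s') := fun s' => by
      rw [← hc1, ← Finset.sum_mul]
      cases c s' <;> simp [cost, hn]
    simp_rw [this]
    rw [Finset.sum_comm, Finset.mul_sum, ← Finset.sum_sub_distrib]
    refine Finset.sum_congr rfl fun s _ => ?_
    rw [Finset.mul_sum, Finset.mul_sum, Finset.mul_sum, ← Finset.sum_sub_distrib]
    exact Finset.sum_congr rfl fun s' _ => by ring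
  have h1 := key v fun s' => sub_nonneg.2 (hv1 s')
  have h2 := key y hy1
  have h3 := mul_le_mul_of_nonneg_left hle M.γ_nonneg
  rw [hcost] at hb
  linarith

end Prescription

/-! ### The decoder's view of a joint policy -/

section Potential

open Classical in
/-- The joint weight of the state `s_t = s` and of the messages `o_0, …, o_t`. -/
def messageWeight (μ : Belief S) (π : JointPolicy S A) (t : ℕ) (o : Fin (t + 1) → Option S)
    (s : S) : ℝ :=
  ∑ x : Fin (t + 1) → S,
    if π.messages (t + 1) x = o ∧ x (Fin.last t) = s then M.pathProb μ π t x else 0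

open Classical in
theorem sum_messageWeight_mul (μ : Belief S) (π : JointPolicy S A) (t : ℕ)
    (o : Fin (t + 1) → Option S) (f : S → ℝ) :
    ∑ s, M.messageWeight μ π t o s * f s =
      ∑ x : Fin (t + 1) → S,
        if π.messages (t + 1) x = o then M.pathProb μ π t x * f (x (Fin.last t)) else 0 := by
  simp_rw [messageWeight, Finset.sum_mul]
  rw [Finset.sum_comm]
  refine Finset.sum_congr rfl fun x _ => ?_
  by_cases h : π.messages (t + 1) x = o <;> simp [h]

theorem messageWeight_nonneg (μ : Belief S) (π : JointPolicy S A) (t : ℕ)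
    (o : Fin (t + 1) → Option S) (s : S) : 0 ≤ M.messageWeight μ π t o s :=
  Finset.sum_nonneg fun x _ => by
    split_ifs
    exacts [M.pathProb_nonneg μ π t x, le_rfl]

theorem sum_messageWeight (μ : Belief S) (π : JointPolicy S A) (t : ℕ) :
    ∑ o, ∑ s, M.messageWeight μ π t o s = 1 := by
  classical
  have h := fun o => M.sum_messageWeight_mul μ π t o fun _ => 1
  simp only [mul_one] at h
  simp_rw [h]
  rw [Finset.sum_comm, ← M.sum_pathProb μ π t]
  exact Finset.sum_congr rfl fun x _ => by simp

open Classical in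
/-- The joint weight of the state `s_{t+1} = s`, of the messages `o_0, …, o_t`, and of the
communication action `c_{t+1} = c`. -/
def commWeight (μ : Belief S) (π : JointPolicy S A) (t : ℕ) (o : Fin (t + 1) → Option S)
    (c : Bool) (s : S) : ℝ :=
  ∑ x : Fin (t + 1) → S,
    if π.messages (t + 1) x = o ∧ π.comm (t + 1) (Fin.snoc x s) = c then
      M.pathProb μ π t x * M.P (x (Fin.last t)) (π.dec t o) s else 0

theorem commWeight_nonneg (μ : Belief S) (π : JointPolicy S A) (t : ℕ)
    (o : Fin (t + 1) → Option S) (c : Bool) (s : S) : 0 ≤ M.commWeight μ π t o c s :=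
  Finset.sum_nonneg fun x _ => by
    split_ifs
    exacts [mul_nonneg (M.pathProb_nonneg μ π t x) (stdSimplex.zero_le _ _), le_rfl]

/-- Whatever history the encoder uses, its two decisions partition the predicted weight, as a
randomized prescription would. -/
theorem commWeight_add (μ : Belief S) (π : JointPolicy S A) (t : ℕ)
    (o : Fin (t + 1) → Option S) (s' : S) :
    M.commWeight μ π t o false s' + M.commWeight μ π t o true s' =
      ∑ s, M.messageWeight μ π t o s * M.P s (π.dec t o) s' := by
  classical
  rw [M.sum_messageWeight_mul μ π t o fun s => M.P s (π.dec t o) s', commWeight, commWeight,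
    ← Finset.sum_add_distrib]
  refine Finset.sum_congr rfl fun x _ => ?_
  cases π.comm (t + 1) (Fin.snoc x s') <;> simp

open Classical in
theorem messageWeight_snoc (μ : Belief S) (π : JointPolicy S A) (t : ℕ)
    (o : Fin (t + 1) → Option S) (m : Option S) (s : S) :
    M.messageWeight μ π (t + 1) (Fin.snoc o m) s =
      ∑ x : Fin (t + 1) → S,
        if π.messages (t + 1) x = o ∧ message s (π.comm (t + 1) (Fin.snoc x s)) = m then
          M.pathProb μ π t x * M.P (x (Fin.last t)) (π.dec t o) s else 0 := by
  have h : ∀ (x : Fin (t + 1) → S) (y : S),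
      π.messages (t + 1 + 1) (Fin.snoc x y) =
        Fin.snoc (π.messages (t + 1) x) (message y (π.comm (t + 1) (Fin.snoc x y))) := by
    intro x y
    rw [JointPolicy.messages, JointPolicy.comm, Fin.init_snoc, Fin.snoc_last]
  rw [messageWeight, sum_snoc]
  refine Finset.sum_congr rfl fun x _ => ?_
  rw [Finset.sum_eq_single s]
  · simp only [h, Fin.snoc_inj, Fin.snoc_last, pathProb_snoc, and_true]
    by_cases hx : π.messages (t + 1) x = o
    · subst hx
      simp [JointPolicy.control]
    · simp [hx]
  · intro y _ hy
    simp [hy]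
  · simp

open Classical in
theorem messageWeight_snoc_none (μ : Belief S) (π : JointPolicy S A) (t : ℕ)
    (o : Fin (t + 1) → Option S) :
    M.messageWeight μ π (t + 1) (Fin.snoc o none) = M.commWeight μ π t o false := by
  have h : ∀ (s : S) (c : Bool), message s c = none ↔ c = false := by
    intro s c
    cases c <;> simp [message]
  ext s
  rw [messageWeight_snoc]
  exact Finset.sum_congr rfl fun x _ => if_congr (and_congr_right fun _ => h s _) rfl rfl

open Classical in
theorem messageWeight_snoc_some (μ : Belief S) (π : JointPolicy S A) (t : ℕ)
    (o : Fin (t + 1) → Option S) (s' : S) :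
    M.messageWeight μ π (t + 1) (Fin.snoc o (some s')) =
      Pi.single s' (M.commWeight μ π t o true s') := by
  have h : ∀ (s : S) (c : Bool), message s c = some s' ↔ c = true ∧ s = s' := by
    intro s c
    cases c <;> simp [message]
  ext s
  by_cases hs : s = s'
  · subst hs
    rw [messageWeight_snoc, Pi.single_eq_same]
    exact Finset.sum_congr rfl fun x _ =>
      if_congr (and_congr_right fun _ => (h s _).trans (and_iff_left rfl)) rfl rfl
  · simp [messageWeight_snoc, h, hs]

/-- Paths are grouped by their messages, which alone determine the control action. -/
theorem shiftedReward_eq (μ : Belief S) (π : JointPolicy S A) (t : ℕ) :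
    M.shiftedReward μ π t =
      ∑ o, (∑ s, M.messageWeight μ π t o s *
          ∑ s', M.P s (π.dec t o) s' * M.r s (π.dec t o) s' -
        M.γ * M.β * ∑ s', M.commWeight μ π t o true s') := by
  classical
  have hc : ∀ o, M.γ * M.β * ∑ s', M.commWeight μ π t o true s' =
      ∑ x : Fin (t + 1) → S, if π.messages (t + 1) x = o then
        M.pathProb μ π t x * ∑ s', M.P (x (Fin.last t)) (π.dec t o) s' *
          (M.γ * M.β * cost (π.comm (t + 1) (Fin.snoc x s'))) else 0 := by
    intro o
    unfold commWeight
    rw [Finset.sum_comm, Finset.mul_sum]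
    refine Finset.sum_congr rfl fun x _ => ?_
    by_cases hx : π.messages (t + 1) x = o
    · simp only [hx, true_and, if_true, Finset.mul_sum]
      refine Finset.sum_congr rfl fun s' _ => ?_
      cases π.comm (t + 1) (Fin.snoc x s') <;> simp [cost]
      ring
    · simp [hx]
  simp_rw [hc]
  have hr := fun o => M.sum_messageWeight_mul μ π t o
    fun s => ∑ s', M.P s (π.dec t o) s' * M.r s (π.dec t o) s'
  simp_rw [hr, ← Finset.sum_sub_distrib]
  rw [Finset.sum_comm]
  refine Finset.sum_congr rfl fun x _ => ?_
  rw [Finset.sum_eq_single (π.messages (t + 1) x)]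
  · simp only [if_true, ← mul_sub, ← Finset.sum_sub_distrib]
    rfl
  · intro o _ ho
    simp [ho.symm]
  · simp

/-- The optimal POMDP value that the decoder expects to go, given the messages so far. -/
def potential (μ : Belief S) (π : JointPolicy S A) (t : ℕ) : ℝ :=
  ∑ o, M.jointPOMDP.optimalValue (M.messageWeight μ π t o)

theorem messageWeight_zero (μ : Belief S) (π : JointPolicy S A) (o : Option S) :
    M.messageWeight μ π 0 (Fin.cons o Fin.elim0) =
      {s | message s (π.enc 0 (fun _ => s) Fin.elim0) = o}.indicator μ := by
  classical
  have hm : ∀ s : S, π.messages (0 + 1) (fun _ => s) =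
      Fin.cons (message s (π.enc 0 (fun _ => s) Fin.elim0)) Fin.elim0 := by
    intro s
    ext1 i
    fin_cases i
    rfl
  have hs : ∀ s : S, (Fin.cons s Fin.elim0 : Fin 1 → S) = fun _ => s := by
    intro s
    ext1 i
    fin_cases i
    rfl
  ext s
  rw [messageWeight, sum_cons]
  simp only [Fintype.sum_subsingleton _ Fin.elim0, hs]
  rw [Finset.sum_eq_single s]
  · simp [hm, Fin.cons_inj, pathProb, Set.indicator_apply]
  · intro y _ hy
    simp [hy]
  · simp

variable [Finite A] [Nonempty A]

theorem abs_potential_le (μ : Belief S) (π : JointPolicy S A) (t : ℕ) :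
    |M.potential μ π t| ≤ M.jointPOMDP.valueBound := by
  refine (Finset.abs_sum_le_sum_abs _ _).trans ?_
  rw [← one_mul M.jointPOMDP.valueBound, ← M.sum_messageWeight μ π t, Finset.sum_mul]
  refine Finset.sum_le_sum fun o _ => (M.jointPOMDP.abs_optimalValue_le _).trans_eq ?_
  simp_rw [abs_of_nonneg (M.messageWeight_nonneg μ π t o _)]

/-- For each message history, `randomized_le_optimalValue` applies with `commWeight` at `false` as
the untransmitted weights. -/
theorem shiftedReward_add_potential_le (μ : Belief S) (π : JointPolicy S A) (t : ℕ) :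
    M.shiftedReward μ π t + M.γ * M.potential μ π (t + 1) ≤ M.potential μ π t := by
  classical
  have hp : M.potential μ π (t + 1) = ∑ o : Fin (t + 1) → Option S, ∑ m,
      M.jointPOMDP.optimalValue (M.messageWeight μ π (t + 1) (Fin.snoc o m)) := by
    rw [potential, sum_snoc]
  rw [hp, shiftedReward_eq, Finset.mul_sum, ← Finset.sum_add_distrib]
  refine Finset.sum_le_sum fun o _ => ?_
  have hadd := M.commWeight_add μ π t o
  have h := M.randomized_le_optimalValue (M.messageWeight μ π t o)
    (M.commWeight μ π t o false) (π.dec t o) (M.commWeight_nonneg μ π t o false)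
    fun s' => by
      rw [← hadd]
      exact le_add_of_nonneg_right (M.commWeight_nonneg μ π t o true s')
  simp_rw [← hadd, add_sub_cancel_left] at h
  rw [Fintype.sum_option, messageWeight_snoc_none]
  simp_rw [messageWeight_snoc_some]
  exact h

theorem objective_le_potential (μ : Belief S) (π : JointPolicy S A) :
    M.objective μ π + M.β * M.commRate μ π 0 ≤ M.potential μ π 0 := by
  have step : ∀ n, ∑ t ∈ Finset.range n, M.γ ^ t * M.shiftedReward μ π t +
      M.γ ^ n * M.potential μ π n ≤ M.potential μ π 0 := by
    intro n
    induction n with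
    | zero => simp
    | succ n ih =>
      refine le_trans ?_ ih
      rw [Finset.sum_range_succ, pow_succ, mul_assoc, add_assoc, ← mul_add]
      exact add_le_add_right (mul_le_mul_of_nonneg_left
        (M.shiftedReward_add_potential_le μ π n) (pow_nonneg M.γ_nonneg n)) _
  -- In the limit the remainder `γ ^ n * potential` vanishes, the potentials being uniformly
  -- bounded.
  have h1 := (M.hasSum_shiftedReward μ π).tendsto_sum_nat
  have h2 := (summable_geometric_mul M.γ_nonneg M.γ_lt_one
    (M.abs_potential_le μ π)).tendsto_atTop_zero
  have h3 := h1.add h2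
  rw [add_zero] at h3
  exact le_of_tendsto' h3 step

/-- The POMDP does at least as well as any causal joint policy with the same first step. -/
theorem objective_le_pomdpObjective_greedy (μ : Belief S) (π : JointPolicy S A) :
    M.objective μ π ≤ M.pomdpObjective μ (fun s => π.enc 0 (fun _ => s) Fin.elim0)
      (M.followBelief μ (fun s => π.enc 0 (fun _ => s) Fin.elim0) M.jointPOMDP.greedy) := by
  have h := M.objective_le_potential μ π
  -- At time 0 the state history is `s_0` alone, so any encoder is a first-step policy there and the
  -- potential is the POMDP value after its message.
  have hp : M.potential μ π 0 =
      ∑ o, μ.mass {s | message s (π.enc 0 (fun _ => s) Fin.elim0) = o} *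
        M.jointPOMDP.beliefValue (initialBelief μ (fun s => π.enc 0 (fun _ => s) Fin.elim0) o)
          M.jointPOMDP.greedy := by
    rw [potential, sum_cons]
    refine Finset.sum_congr rfl fun o _ => ?_
    rw [Fintype.sum_subsingleton _ Fin.elim0, messageWeight_zero,
      beliefValue_greedy, ← M.jointPOMDP.optimalValue_smul (Belief.mass_nonneg _ _)]
    congr 1
    ext s
    exact (Belief.mass_mul_condition _ _ s).symm
  rw [commRate_zero, hp] at h
  rw [pomdpObjective_eq]
  exact le_sub_iff_add_le.2 h

theorem isOptimal_split_iff (μ : Belief S) (e₀ : S → Bool)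
    (π : Option S → HistoryPolicy (Option S) (A × (S → Bool))) :
    M.IsOptimal μ (split e₀ π) ↔ ∀ e₀' π',
      M.pomdpObjective μ e₀' π' ≤ M.pomdpObjective μ e₀ π := by
  constructor
  · intro h e₀' π'
    rw [← objective_split, ← objective_split]
    exact h _
  · intro h π'
    rw [objective_split]
    exact (M.objective_le_pomdpObjective_greedy μ π').trans (h _ _)

theorem isOptimal_split_followBelief {μ : Belief S} {π : BeliefPolicy S (A × (S → Bool))}
    (hπ : ∀ ω₀ ∈ initialBeliefs μ, M.jointPOMDP.IsOptimalBeliefPolicy ω₀ π) {e₀ : S → Bool}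
    (he : M.IsOptimalFirstStep μ π e₀) :
    M.IsOptimal μ (split e₀ (M.followBelief μ e₀ π)) := by
  rw [isOptimal_split_iff]
  intro e₀' π'
  refine le_trans (Finset.sum_le_sum fun s _ => ?_) (he e₀')
  -- Optimality of `π` is known only for beliefs reached from states of positive mass; the other
  -- terms are zero.
  rcases (stdSimplex.zero_le μ s).eq_or_lt with h | h
  · rw [← h, zero_mul, zero_mul]
  · exact mul_le_mul_of_nonneg_left (sub_le_sub_right
      ((hπ _ ⟨e₀', s, h, rfl⟩).value_le _) _) h.le

end Potential

end Model
end RemoteControl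
end

theorem mainTheorem2 {S A : Type*} [Fintype S] [Fintype A] [Nonempty A]
    (M : RemoteControl.Model S A) :
    -- all the series of expected discounted rewards converge
    (∀ (μ : RemoteControl.Belief S) (π : RemoteControl.JointPolicy S A),
      Summable fun t : ℕ => M.γ ^ t * M.stageReward μ π t) ∧
    (∀ (ω₀ : RemoteControl.Belief S)
        (π : RemoteControl.HistoryPolicy (Option S) (A × (S → Bool))),
      Summable fun t : ℕ => M.γ ^ t * M.jointPOMDP.stageReward ω₀ π t) ∧
    -- splitting is a bijection onto the joint policies whose encoder uses the current state and
    -- the past messages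
    (Function.Injective fun p : (S → Bool) ×
        (Option S → RemoteControl.HistoryPolicy (Option S) (A × (S → Bool))) =>
      RemoteControl.Model.split p.1 p.2) ∧
    (Set.range fun p : (S → Bool) ×
        (Option S → RemoteControl.HistoryPolicy (Option S) (A × (S → Bool))) =>
      RemoteControl.Model.split p.1 p.2) = {π | π.IsReduced} ∧
    -- splitting preserves the objective
    (∀ (μ : RemoteControl.Belief S) (e₀ : S → Bool)
        (π : Option S → RemoteControl.HistoryPolicy (Option S) (A × (S → Bool))),
      M.objective μ (RemoteControl.Model.split e₀ π) = M.pomdpObjective μ e₀ π) ∧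
    -- optimality in the POMDP is the same as optimality among all causal joint policies
    (∀ (μ : RemoteControl.Belief S) (e₀ : S → Bool)
        (π : Option S → RemoteControl.HistoryPolicy (Option S) (A × (S → Bool))),
      M.IsOptimal μ (RemoteControl.Model.split e₀ π) ↔
        ∀ (e₀' : S → Bool)
          (π' : Option S → RemoteControl.HistoryPolicy (Option S) (A × (S → Bool))),
          M.pomdpObjective μ e₀' π' ≤ M.pomdpObjective μ e₀ π) ∧
    -- the POMDP has a stationary deterministic belief policy that is optimal for every initial
    -- belief at once
    (∃ π : RemoteControl.BeliefPolicy S (A × (S → Bool)),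
      ∀ ω₀ : RemoteControl.Belief S, M.jointPOMDP.IsOptimalBeliefPolicy ω₀ π) ∧
    -- an optimal belief policy is optimal among all history-dependent policies
    (∀ (ω₀ : RemoteControl.Belief S) (π : RemoteControl.BeliefPolicy S (A × (S → Bool))),
      M.jointPOMDP.IsOptimalBeliefPolicy ω₀ π →
        ∀ π' : RemoteControl.HistoryPolicy (Option S) (A × (S → Bool)),
          M.jointPOMDP.value ω₀ π' ≤ M.jointPOMDP.beliefValue ω₀ π) ∧
    -- split, with an optimal first step, it gives an optimal joint encoder/decoder policy
    (∀ (μ : RemoteControl.Belief S) (π : RemoteControl.BeliefPolicy S (A × (S → Bool))),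
      (∀ ω₀ ∈ RemoteControl.Model.initialBeliefs μ,
        M.jointPOMDP.IsOptimalBeliefPolicy ω₀ π) →
        (∃ e₀ : S → Bool, M.IsOptimalFirstStep μ π e₀) ∧
        ∀ e₀ : S → Bool, M.IsOptimalFirstStep μ π e₀ →
          M.IsOptimal μ (RemoteControl.Model.split e₀ (M.followBelief μ e₀ π))) := by
  refine ⟨M.summable_stageReward, M.jointPOMDP.summable_stageReward,
    RemoteControl.Model.split_injective, RemoteControl.Model.range_split,
    fun μ e₀ π => M.objective_split e₀ π μ, M.isOptimal_split_iff,
    ⟨M.jointPOMDP.greedy, M.jointPOMDP.isOptimalBeliefPolicy_greedy⟩,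
    fun _ _ h => h.value_le, fun μ π hπ => ⟨?_, fun _ => M.isOptimal_split_followBelief hπ⟩⟩
  exact Finite.exists_max fun e₀ : S → Bool =>
    ∑ s, μ s * (M.jointPOMDP.beliefValue
      (RemoteControl.Model.initialBelief μ e₀ (RemoteControl.message s (e₀ s))) π
        - M.β * RemoteControl.cost (e₀ s))
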